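/- For elements $x,y$ of a group $G$ put $[x,y]=x^{-1}y^{-1}xy$, $[x,_0y]=x$ and $[x,_{n+1}y]=[[x,_ny],y]$ for $n\ge 0$. Let $L_4(G)$ be the set of left $4$-Engel elements of $G$, that is, of all $x\in G$ with $[g,_4x]=1$ for every $g\in G$. Let $B(G)$ be the Baer radical of $G$, that is, the subgroup generated by all cyclic subnormal subgroups of $G$. Theorem 1.6. Let $G$ be a group, let $p$ be a prime, and let $a\in G$ be a $p$-element (its order is finite and a power of $p$) such that both $a\in L_4(G)$ and $a^{-1}\in L_4(G)$. 1. If $p=2$, then $a^4\in B(G)$. 2. If $p$ is odd, then $a^p\in B(G)$. -/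

import Mathlib

/-- The commutator `[x, y] = x⁻¹ y⁻¹ x y` (Mathlib's `⁅x, y⁆` is `x y x⁻¹ y⁻¹`). -/
def rcomm {G : Type*} [Group G] (x y : G) : G := x⁻¹ * y⁻¹ * x * y

/-- The `n`-Engel commutator `[x,ₙ y]`: `[x,₀ y] = x` and `[x,ₙ₊₁ y] = [[x,ₙ y], y]`. -/
def engelComm {G : Type*} [Group G] (x y : G) : ℕ → G
  | 0 => x
  | n + 1 => rcomm (engelComm x y n) y

/-- `leftEngel G n` is the set `Lₙ(G)` of all left `n`-Engel elements of `G`. -/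
def leftEngel (G : Type*) [Group G] (n : ℕ) : Set G :=
  {x | ∀ g : G, engelComm g x n = 1}

/-- The Baer radical `B(G)`: the subgroup generated by all cyclic subnormal subgroups of `G`. -/
def baerRadical (G : Type*) [Group G] : Subgroup G :=
  sSup {H : Subgroup G | IsCyclic H ∧ H.IsSubnormal}

/-! ### Engel conditions rewritten for a conjugate of `a` -/

section Engel

variable {G : Type*} [Group G]

/-! Let `b` be a conjugate of `a`. The Engel identities for `a` and for `a⁻¹` give two formulas for
the same conjugate of `b`; comparing them bounds the class of `⟨a, [a, b]⟩` by 2. Using this also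
for the pairs `(b, a)` and `(aᵇ, bᵃ)` bounds the class of `⟨a, b⟩` by 4
(`exists_commutators_of_leftEngel`).

Suppose `a ^ q = 1` with `q = p ^ n`, and put `m = p ^ (n - 1)`. Collection in `⟨a, b⟩` shows that
`a ^ m` and `b ^ m` commute if `n > s`, where `s = 1` for odd `p` and `s = 2` for `p = 2`
(`commute_pow_of_leftEngel`). So the normal closure `N` of `a ^ m` is abelian. By induction on `n`,
applied in `G ⧸ N`, the subgroup `⟨a ^ p ^ s⟩N` is subnormal. As `a` acts on the abelian group `N`
as an Engel element, `⟨a ^ p ^ s⟩` is subnormal in `⟨a ^ p ^ s⟩N` (`isSubnormal_zpowers_of_sup`),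
hence in `G`. -/

theorem map_engelComm {H : Type*} [Group H] (f : G →* H) (x y : G) (n : ℕ) :
    f (engelComm x y n) = engelComm (f x) (f y) n := by
  induction n with
  | zero => rfl
  | succ n ih => simp [engelComm, rcomm, ih]

theorem map_mem_leftEngel {H : Type*} [Group H] {f : G →* H} (hf : Function.Surjective f)
    {a : G} {n : ℕ} (ha : a ∈ leftEngel G n) : f a ∈ leftEngel H n := by
  intro h
  obtain ⟨g, rfl⟩ := hf h
  rw [← map_engelComm, ha g, map_one]

theorem conj_mem_leftEngel {a : G} {n : ℕ} (ha : a ∈ leftEngel G n) (g : G) :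
    g⁻¹ * a * g ∈ leftEngel G n := by
  simpa using map_mem_leftEngel (f := (MulAut.conj g⁻¹).toMonoidHom)
    (MulAut.conj g⁻¹).surjective ha

theorem rcomm_eq_inv_mul_conj (z a : G) : rcomm z a = z⁻¹ * MulAut.conj a⁻¹ z := by
  simp [rcomm, mul_assoc]

/-- This trades `g` for `b`: `[g, a] = b⁻¹a`, and each further commutator with `a` is `z ↦ z⁻¹
A(z)`, so the fourth is trivial exactly when `A` fixes the third. -/
theorem conj_fixed_of_engelComm_eq_one {a g b : G} (hb : b = g⁻¹ * a * g)
    (h : engelComm g a 4 = 1) :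
    MulAut.conj a⁻¹ ((b * (MulAut.conj a⁻¹ b)⁻¹)⁻¹ * MulAut.conj a⁻¹ (b * (MulAut.conj a⁻¹ b)⁻¹)) =
      (b * (MulAut.conj a⁻¹ b)⁻¹)⁻¹ * MulAut.conj a⁻¹ (b * (MulAut.conj a⁻¹ b)⁻¹) := by
  set A := MulAut.conj a⁻¹ with hA
  have h1 : engelComm g a 1 = b⁻¹ * a := by subst hb; simp [engelComm, rcomm, mul_assoc]
  have hr (z : G) : rcomm z a = z⁻¹ * A z := rcomm_eq_inv_mul_conj z a
  have hAa : A a = a := by simp [hA]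
  have h2 : engelComm g a 2 = A (b * (A b)⁻¹) := by
    have : engelComm g a 2 = rcomm (engelComm g a 1) a := rfl
    rw [this, h1, hr]
    simp only [map_mul, map_inv, hAa]
    simp [hA, mul_assoc]
  have h4 : engelComm g a 4 = rcomm (rcomm (engelComm g a 2) a) a := rfl
  rw [h4, h2, hr, hr, inv_mul_eq_one] at h
  apply A.injective
  simpa [mul_assoc] using h.symm

/-- If `a` and `a⁻¹` are left `4`-Engel and `b` is a conjugate of `a`, then `[a, b]` and `a`
generate a group of class at most `2`. -/
theorem commute_rcomm_of_leftEngel {a : G} (ha : a ∈ leftEngel G 4) (ha' : a⁻¹ ∈ leftEngel G 4)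
    {b : G} (hb : IsConj a b) :
    Commute (rcomm (rcomm a b) a) (rcomm a b) ∧ Commute (rcomm (rcomm a b) a) a := by
  obtain ⟨g, rfl⟩ := isConj_iff.1 hb
  -- `key` is the assertion for the commutator `[b⁻¹, a]`, which is conjugate to `[a, b]`
  have key {a g b : G} (hb : b = g⁻¹ * a * g) (h : engelComm g a 4 = 1)
      (h' : engelComm g a⁻¹ 4 = 1) :
      Commute (b * (MulAut.conj a⁻¹ b)⁻¹) (MulAut.conj a⁻¹ (b * (MulAut.conj a⁻¹ b)⁻¹)) ∧
      MulAut.conj a⁻¹ ((b * (MulAut.conj a⁻¹ b)⁻¹)⁻¹ *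
        MulAut.conj a⁻¹ (b * (MulAut.conj a⁻¹ b)⁻¹)) =
      (b * (MulAut.conj a⁻¹ b)⁻¹)⁻¹ * MulAut.conj a⁻¹ (b * (MulAut.conj a⁻¹ b)⁻¹) := by
    have e1 := conj_fixed_of_engelComm_eq_one hb h
    have e2 := conj_fixed_of_engelComm_eq_one (b := b⁻¹) (by rw [hb]; group) h'
    refine ⟨?_, e1⟩
    set A := MulAut.conj a⁻¹ with hA
    have hAi : MulAut.conj a⁻¹⁻¹ = A⁻¹ := by simp [hA]
    rw [hAi] at e2
    set b1 := A b with hb1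
    set b2 := A b1 with hb2
    set b3 := A b2 with hb3
    have e3 : A⁻¹ ((b⁻¹ * (A⁻¹ b⁻¹)⁻¹)⁻¹ * A⁻¹ (b⁻¹ * (A⁻¹ b⁻¹)⁻¹)) = _ := e2
    -- The identity for `a⁻¹` involves `A⁻¹ b`, ..., `A⁻³ b`; shifting by `A³` puts it in the same
    -- letters `b`, ..., `b3` as `e1`.
    replace e3 := congrArg (fun z => A (A (A z))) e3
    simp only [map_mul, map_inv, MulAut.apply_inv_self, inv_inv, mul_inv_rev, ← hb1, ← hb2,
      ← hb3] at e3
    simp only [map_mul, map_inv, mul_inv_rev, inv_inv, ← hb1, ← hb2, ← hb3] at e1 ⊢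
    -- `e1` and `e3` compute `b3` in two ways
    have f1 : b3 = b2 * b1⁻¹ * b * b1⁻¹ * b2 * b1⁻¹ * b2 := by
      have : b3⁻¹ = (b2 * b1⁻¹ * b2)⁻¹ * (b1 * b⁻¹ * (b1 * b2⁻¹)) := by rw [← e1]; group
      rw [← inv_inv b3, this]; group
    have f2 : b3 = b2 * b1⁻¹ * b2 * b1⁻¹ * b * b1⁻¹ * b2 := by
      have h3 : b3 = b2 * (b2⁻¹ * b3 * (b2⁻¹ * b1)) * b1⁻¹ * b2 := by group
      rw [h3, ← e3]
      group
    have f3 : b * b1⁻¹ * b2 = b2 * b1⁻¹ * b := by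
      have := f1.symm.trans f2
      have h4 : b * b1⁻¹ * b2 = (b2 * b1⁻¹)⁻¹ * (b2 * b1⁻¹ * b * b1⁻¹ * b2 * b1⁻¹ * b2) *
        (b1⁻¹ * b2)⁻¹ := by group
      rw [h4, this]; group
    have f4 : Commute (b * b1⁻¹) (b1 * b2⁻¹)⁻¹ := by
      rw [Commute, SemiconjBy]
      calc b * b1⁻¹ * (b1 * b2⁻¹)⁻¹ = (b * b1⁻¹ * b2) * b1⁻¹ := by group
        _ = _ := by rw [f3]; group
    exact Commute.inv_right_iff.1 f4
  -- Inverting both `a` and `b` makes the element `d` of `key` satisfy `A d = [a, b]`.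
  obtain ⟨k1, k2⟩ := key (a := a⁻¹) (g := g⁻¹) (b := (g * a * g⁻¹)⁻¹) (by group) (ha' _)
    (by rw [inv_inv]; exact ha _)
  set b := g * a * g⁻¹
  set A := MulAut.conj a⁻¹ with hA
  have hAi : MulAut.conj a⁻¹⁻¹ = A⁻¹ := by simp [hA]
  rw [hAi] at k1 k2
  set d := b⁻¹ * (A⁻¹ b⁻¹)⁻¹ with hd
  have hdt : rcomm a b = A d := by simp [hd, hA, rcomm, mul_assoc]
  have hx : rcomm (rcomm a b) a = (A d)⁻¹ * A (A d) := by rw [hdt, rcomm_eq_inv_mul_conj]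
  have k3 : A d * A (A d) = A (A d) * A d := by
    have := congrArg (fun z => A (A z)) k1.eq
    simpa using this.symm
  have k4 : A ((A d)⁻¹ * A (A d)) = (A d)⁻¹ * A (A d) := by
    have := congrArg (fun z => (A (A (A z)))⁻¹) k2
    simp only [map_mul, map_inv, MulAut.apply_inv_self, mul_inv_rev, inv_inv] at this
    rw [map_mul, map_inv]
    exact this.symm
  rw [hx, hdt]
  refine ⟨((Commute.refl _).inv_left).mul_left k3.symm, ?_⟩
  have : a⁻¹ * ((A d)⁻¹ * A (A d)) * a = (A d)⁻¹ * A (A d) := by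
    have := k4
    rwa [hA, MulAut.conj_apply, inv_inv] at this
  rw [Commute, SemiconjBy]
  conv_rhs => rw [← this]
  group

end Engel

/-! ### The group generated by two conjugates -/

section TwoConjugates

variable {G : Type*} [Group G]

/-- Let `t = [a, b]`, `x = [t, a]`, `y = [t, b]`, where `x` commutes with `a` and `t`, and `y`
commutes with `b` and `t`. If also `txy = [aᵇ, bᵃ]` and `[txy, aᵇ]` commutes with `aᵇ`, then
`⟨a, b⟩` is nilpotent of class at most `4`. -/
theorem exists_central_of_commute {a b t x y : G} (ht : a * b = b * a * t) (hx : t * a = a * t * x)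
    (hy : t * b = b * t * y) (hxt : Commute x t) (hxa : Commute x a) (hyt : Commute y t)
    (hyb : Commute y b) (hs : Commute (rcomm (t * x * y) (a * t)) (a * t)) :
    ∃ w, x * b = b * (x * w) ∧ Commute x y ∧ Commute w a ∧ Commute w b ∧ Commute w t ∧
      Commute w x ∧ Commute w y := by
  obtain ⟨A, hA⟩ : ∃ A, A = MulAut.conj a⁻¹ := ⟨_, rfl⟩
  obtain ⟨B, hB⟩ : ∃ B, B = MulAut.conj b⁻¹ := ⟨_, rfl⟩
  obtain ⟨T, hT⟩ : ∃ T, T = MulAut.conj t⁻¹ := ⟨_, rfl⟩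
  have At : A t = t * x := by simp [hA, mul_assoc, hx]
  have Ax : A x = x := by simp [hA, mul_assoc, hxa.eq]
  have Bt : B t = t * y := by simp [hB, mul_assoc, hy]
  have By : B y = y := by simp [hB, mul_assoc, hyb.eq]
  have Tt : T t = t := by simp [hT]
  have Tx : T x = x := by simp [hT, mul_assoc, hxt.eq]
  have Ty : T y = y := by simp [hT, mul_assoc, hyt.eq]
  -- The relation `ab = bat` among inner automorphisms; applied to `t`, `y`, `v` and one more
  -- element, it drives the computation.
  have hBA (z : G) : B (A z) = T (A (B z)) := by
    have : MulAut.conj b⁻¹ * MulAut.conj a⁻¹ = MulAut.conj t⁻¹ * MulAut.conj a⁻¹ *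
        MulAut.conj b⁻¹ := by
      rw [← map_mul, ← map_mul, ← map_mul]
      congr 1
      rw [← mul_inv_rev, ht]; group
    rw [hA, hB, hT]
    exact DFunLike.congr_fun this z
  obtain ⟨y1, hy1⟩ : ∃ y1, y1 = A y := ⟨_, rfl⟩
  have hy1t : Commute y1 (t * x) := by rw [hy1, ← At]; exact hyt.map A
  have Ty1 : T y1 = x * y1 * x⁻¹ := by
    have : y1 * t * x = t * x * y1 := by rw [mul_assoc]; exact hy1t.eq
    simp only [hT, MulAut.conj_apply, inv_inv]
    calc t⁻¹ * y1 * t = t⁻¹ * (y1 * t * x) * x⁻¹ := by group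
      _ = _ := by rw [this]; group
  have hxA : x = t⁻¹ * A t := by rw [At]; group
  have Bx : B x = y⁻¹ * x * x * y1 * x⁻¹ := by
    rw [hxA, map_mul, map_inv, hBA, Bt, map_mul, map_mul, ← hy1, At, map_mul, Tt, Tx, Ty1]
    simp [mul_assoc]
  -- `v` is `B⁻¹ x`, and it inherits from `x` that `A` fixes it. The central element will be `w =
  -- xv⁻¹`.
  obtain ⟨v, hv⟩ : ∃ v, v = y * x * y1⁻¹ := ⟨_, rfl⟩
  have Bv : B v = x := by
    have : B y1 = T y1 := by rw [hy1, hBA, By]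
    rw [hv, map_mul, map_mul, map_inv, this, By, Bx, Ty1]; group
  have Av : A v = v := B.injective (by rw [hBA, Bv, Ax, Tx])
  have hvt : v = t * (x * y1⁻¹ * y) * t⁻¹ := by
    apply B.injective
    have : B y1 = T y1 := by rw [hy1, hBA, By]
    rw [Bv]
    simp only [map_mul, map_inv, Bt, Bx, By, this, Ty1]
    calc x = x * t * t⁻¹ := by group
      _ = t * x * t⁻¹ := by rw [hxt.eq]
      _ = _ := by group
  have Tv : T v = x * y1⁻¹ * y := by rw [hvt, hT, MulAut.conj_apply]; group
  have hy1v : y1 = v⁻¹ * y * x := by rw [hv]; group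
  have Tv' : T v = y⁻¹ * v * y := by rw [Tv, hy1v]; group
  have hTAs : T (A (t * x * y)) = t * x * x * x * v⁻¹ * y := by
    simp only [map_mul, At, Ax, ← hy1, Tt, Tx, Ty1]; rw [hy1v]; group
  have hTA (z : G) : (a * t)⁻¹ * z * (a * t) = T (A z) := by simp [hT, hA, mul_assoc]
  have hq : rcomm (t * x * y) (a * t) = y⁻¹ * x * x * v⁻¹ * y := by
    calc _ = (t * x * y)⁻¹ * ((a * t)⁻¹ * (t * x * y) * (a * t)) := by simp [rcomm, mul_assoc]
      _ = _ := by rw [hTA, hTAs]; group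
  -- The only use of `hs`; it forces `v` to have the same conjugate under `x` and `y`.
  have hqf : T (A (y⁻¹ * x * x * v⁻¹ * y)) = y⁻¹ * x * x * v⁻¹ * y := by
    rw [← hTA, ← hq, mul_assoc, hs.eq]; group
  simp only [map_mul, map_inv, ← hy1, Ax, Av, Tx] at hqf
  have hv_conj : y⁻¹ * v * y = x⁻¹ * v * x := by
    have h : T y1 = x * v⁻¹ * y := by rw [Ty1, hy1v]; group
    rw [h, Tv'] at hqf
    rw [← inv_inj]
    calc (y⁻¹ * v * y)⁻¹ = x⁻¹ * v⁻¹ * y * ((x * v⁻¹ * y)⁻¹ * x * x * (y⁻¹ * v * y)⁻¹ *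
          (x * v⁻¹ * y)) * y⁻¹ * v * x⁻¹ := by group
      _ = _ := by rw [hqf]; group
  have hx_conj : y * x * y⁻¹ = x⁻¹ * v * x * x * v⁻¹ := by
    have h : T y1 = x⁻¹ * v⁻¹ * x * y * x := by
      rw [hy1v, map_mul, map_mul, map_inv, Tx, Ty, Tv', hv_conj]; group
    rw [Ty1, hy1v] at h
    calc y * x * y⁻¹ = x⁻¹ * v * x * (x⁻¹ * v⁻¹ * x * y * x) * y⁻¹ := by group
      _ = _ := by rw [← h]; group
  -- An `A`-fixed `u` with `B u = v` suffices: `hBA` at `u` then reads `v = T (A v) = T v`.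
  have Tvf : T v = v := by
    have hB' : v = B ((y * x * y⁻¹)⁻¹ * v * v) := by
      simp only [map_mul, map_inv, By, Bv, Bx]
      rw [hy1v]; group
    have hA' : A ((y * x * y⁻¹)⁻¹ * v * v) = (y * x * y⁻¹)⁻¹ * v * v := by
      rw [hx_conj]; simp only [map_mul, map_inv, Ax, Av]
    have := hBA ((y * x * y⁻¹)⁻¹ * v * v)
    rw [hA', ← hB', Av] at this
    exact this.symm
  have hxv : Commute x v := by
    have : x * v = x * (x⁻¹ * v * x) := by rw [← hv_conj, ← Tv', Tvf]
    rw [Commute, SemiconjBy, this]; group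
  have hvy : Commute v y := by
    have : y * v = y * (y⁻¹ * v * y) := by rw [← Tv', Tvf]
    rw [Commute, SemiconjBy, this]; group
  have hxy : Commute x y := by
    have : y * x * y⁻¹ = x := by
      rw [hx_conj, mul_assoc x⁻¹ v, ← hxv.eq, mul_assoc x⁻¹, mul_assoc x, ← hxv.eq]; group
    rw [Commute, SemiconjBy]
    nth_rw 1 [← this]
    group
  have hvt : Commute v t := by
    have := Tvf
    rw [hT, MulAut.conj_apply, inv_inv] at this
    rw [Commute, SemiconjBy]
    conv_rhs => rw [← this]
    group
  have hva : Commute v a := by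
    have : A v = v := Av
    rw [hA, MulAut.conj_apply, inv_inv] at this
    rw [Commute, SemiconjBy]
    conv_rhs => rw [← this]
    group
  have hBx : B x = x * (x * v⁻¹) := by
    have h1 : Commute (x * x * v⁻¹) y := (hxy.mul_left hxy).mul_left hvy.inv_left
    calc B x = y⁻¹ * (x * x * v⁻¹ * y) := by rw [Bx, hy1v]; group
      _ = _ := by rw [h1.eq]; group
  refine ⟨x * v⁻¹, ?_, hxy, hxa.mul_left hva.inv_left, ?_, hxt.mul_left hvt.inv_left,
    (Commute.refl x).mul_left hxv.symm.inv_left, hxy.mul_left hvy.inv_left⟩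
  · rw [← hBx, hB, MulAut.conj_apply]; group
  · have : B (x * v⁻¹) = x * v⁻¹ := by
      rw [map_mul, map_inv, Bv, hBx]
      calc x * (x * v⁻¹) * x⁻¹ = x * (v⁻¹ * x) * x⁻¹ := by rw [hxv.inv_right.eq]
        _ = _ := by group
    rw [hB, MulAut.conj_apply, inv_inv] at this
    rw [Commute, SemiconjBy]
    conv_rhs => rw [← this]
    group

/-- The structure of the group generated by two conjugates of a left `4`-Engel element whose
inverse is left `4`-Engel too. -/
theorem exists_commutators_of_leftEngel {a b : G} (ha : a ∈ leftEngel G 4)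
    (ha' : a⁻¹ ∈ leftEngel G 4) (hab : IsConj a b) :
    ∃ t x y w, a * b = b * a * t ∧ t * a = a * t * x ∧ t * b = b * t * y ∧ x * b = b * (x * w) ∧
      Commute x t ∧ Commute x a ∧ Commute y t ∧ Commute y b ∧ Commute x y ∧
      Commute w a ∧ Commute w b ∧ Commute w t ∧ Commute w x ∧ Commute w y := by
  obtain ⟨h1, h2⟩ := commute_rcomm_of_leftEngel ha ha' hab
  have hconj {c : G} (hc : IsConj a c) : c ∈ leftEngel G 4 ∧ c⁻¹ ∈ leftEngel G 4 := by
    obtain ⟨g, rfl⟩ := isConj_iff.1 hc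
    refine ⟨by simpa using conj_mem_leftEngel ha g⁻¹, ?_⟩
    have := conj_mem_leftEngel ha' g⁻¹
    rw [inv_inv] at this
    simpa [mul_assoc] using this
  obtain ⟨h3, h4⟩ := commute_rcomm_of_leftEngel (hconj hab).1 (hconj hab).2 hab.symm
  have hba : rcomm b a = (rcomm a b)⁻¹ := by simp [rcomm, mul_assoc]
  obtain ⟨t, ht⟩ : ∃ t, t = rcomm a b := ⟨_, rfl⟩
  rw [hba, ← ht] at h3 h4
  rw [← ht] at h1 h2
  -- `[t⁻¹, b]` is inverse to `[t, b]`, because one of them commutes with `t`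
  have hy : rcomm t b = (rcomm t⁻¹ b)⁻¹ := by
    have : rcomm t b = t⁻¹ * (rcomm t⁻¹ b)⁻¹ * t := by simp [rcomm, mul_assoc]
    rw [this, mul_assoc, ((Commute.inv_right_iff.1 h3.inv_left)).eq]; group
  have h5 : Commute (rcomm t b) t := by rw [hy]; exact (Commute.inv_right_iff.1 h3.inv_left)
  have h6 : Commute (rcomm t b) b := by rw [hy]; exact h4.inv_left
  have ht' : a * b = b * a * t := by rw [ht, rcomm]; group
  have hx' : t * a = a * t * rcomm t a := by rw [rcomm]; group
  have hy' : t * b = b * t * rcomm t b := by rw [rcomm]; group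
  -- Here `a * t = aᵇ` and `b * t⁻¹ = bᵃ`, again two conjugates of `a`.
  have hs : rcomm (a * t) (b * t⁻¹) = t * rcomm t a * rcomm t b := by
    generalize rcomm t a = x at *
    generalize rcomm t b = y at *
    have e : b * t⁻¹ * (a * t) * (t * x * y) = a * t * (b * t⁻¹) := by
      calc b * t⁻¹ * (a * t) * (t * x * y)
          = b * t⁻¹ * (a * t * x) * (x⁻¹ * (t * x)) * y := by group
        _ = b * a * t * y := by rw [← hx', ← h1.eq]; group
        _ = a * (b * y) := by rw [← ht', mul_assoc]
        _ = a * (b * (y * t) * t⁻¹) := by group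
        _ = a * (t * b) * t⁻¹ := by rw [h5.eq, hy']; group
        _ = _ := by group
    have e2 : rcomm (a * t) (b * t⁻¹) = (b * t⁻¹ * (a * t))⁻¹ * (a * t * (b * t⁻¹)) := by
      rw [rcomm]; group
    rw [e2, ← e]; group
  have hat : IsConj a (a * t) := isConj_iff.2 ⟨b⁻¹, by rw [inv_inv, mul_assoc, ht']; group⟩
  have hbt : IsConj b (b * t⁻¹) := isConj_iff.2 ⟨a⁻¹, by
    calc a⁻¹ * b * a⁻¹⁻¹ = a⁻¹ * (b * a * t) * t⁻¹ := by group
      _ = _ := by rw [← ht']; group⟩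
  have h7 := (commute_rcomm_of_leftEngel (hconj hat).1 (hconj hat).2
    ((hat.symm.trans hab).trans hbt)).2
  rw [hs] at h7
  obtain ⟨w, hw⟩ := exists_central_of_commute ht' hx' hy' h1 h2 h5 h6 h7
  exact ⟨t, _, _, w, ht', hx', hy', hw.1, h1, h2, h5, h6, hw.2⟩

end TwoConjugates

/-! ### Collection of powers -/

section Powers

variable {G : Type*} [Group G]

theorem MulAut.pow_apply_of_unipotent (A : MulAut G) {b s z : G} (hb : A b = b * s)
    (hs : A s = s * z) (hz : A z = z) (hsz : Commute s z) (n : ℕ) :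
    (A ^ n) b = b * s ^ n * z ^ n.choose 2 := by
  induction n with
  | zero => simp
  | succ n ih =>
    rw [pow_succ', MulAut.mul_apply, ih, map_mul, map_mul, map_pow, map_pow, hb, hs, hz,
      hsz.mul_pow, Nat.choose_succ_succ' n 1, Nat.choose_one_right, pow_succ' s, pow_add z]
    simp only [mul_assoc]

theorem MulAut.pow_apply_of_mul (A : MulAut G) {s z : G} (hs : A s = s * z) (hz : A z = z)
    (n : ℕ) : (A ^ n) s = s * z ^ n := by
  simpa using MulAut.pow_apply_of_unipotent A (s := z) (z := 1) hs (by simpa using hz) (by simp)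
    (Commute.one_right _) n

theorem mul_pow_of_conj {b e f : G} (he : MulAut.conj b⁻¹ e = e * f) (hf : MulAut.conj b⁻¹ f = f)
    (hef : Commute e f) (n : ℕ) : (b * e) ^ n = b ^ n * e ^ n * f ^ n.choose 2 := by
  induction n with
  | zero => simp
  | succ n ih =>
    have h : e ^ n * f ^ n.choose 2 * b = b * (e ^ n * f ^ n * f ^ n.choose 2) := by
      have : MulAut.conj b⁻¹ (e ^ n * f ^ n.choose 2) = e ^ n * f ^ n * f ^ n.choose 2 := by
        rw [map_mul, map_pow, map_pow, he, hf, hef.mul_pow]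
      rw [← this, MulAut.conj_apply]; group
    calc (b * e) ^ (n + 1) = b ^ n * (e ^ n * f ^ n.choose 2 * b) * e := by
          rw [pow_succ, ih]; simp only [mul_assoc]
      _ = b ^ n * b * (e ^ n * (f ^ (n + n.choose 2) * e)) := by
          rw [h, pow_add]; simp only [mul_assoc]
      _ = _ := by
          rw [← (hef.pow_right _).eq, Nat.choose_succ_succ' n 1, Nat.choose_one_right, pow_succ b,
            pow_succ e]
          simp only [mul_assoc]

/-- Conjugation by `a ^ m` takes `b` to `b * e`, and `(b * e) ^ m = b ^ m * e ^ m * f ^ m.choose 2`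
with `f = [e, b]`. The numerical hypotheses kill `e ^ m` (powers of `t` and `x`) and `f ^ m.choose
2` (powers of `y` and `w`). -/
theorem commute_pow_of_leftEngel {a b : G} (ha : a ∈ leftEngel G 4) (ha' : a⁻¹ ∈ leftEngel G 4)
    (hab : IsConj a b) {q m j : ℕ} (hq : a ^ q = 1) (hj : m * m = q * j) (hj' : q ∣ j * q.choose 2)
    (hm : q ∣ m * m.choose 2) (hqm : q.gcd (q.choose 2) ∣ m.choose 2 * m.choose 2) :
    Commute (a ^ m) (b ^ m) := by
  obtain ⟨t, x, y, w, ht, hx, hy, hw, hxt, hxa, hyt, hyb, hxy, hwa, hwb, hwt, hwx, hwy⟩ :=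
    exists_commutators_of_leftEngel ha ha' hab
  have hbq : b ^ q = 1 := by
    obtain ⟨g, rfl⟩ := isConj_iff.1 hab
    rw [conj_pow, hq]; simp
  obtain ⟨A, hA⟩ : ∃ A, A = MulAut.conj a⁻¹ := ⟨_, rfl⟩
  obtain ⟨B, hB⟩ : ∃ B, B = MulAut.conj b⁻¹ := ⟨_, rfl⟩
  have Aq : A ^ q = 1 := by rw [hA, ← map_pow, inv_pow, hq, inv_one, map_one]
  have Bq : B ^ q = 1 := by rw [hB, ← map_pow, inv_pow, hbq, inv_one, map_one]
  have At : A t = t * x := by simp [hA, mul_assoc, hx]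
  have Ax : A x = x := by simp [hA, mul_assoc, hxa.eq]
  have Ab : A b = b * t⁻¹ := by
    have : b * a = a * b * t⁻¹ := by rw [ht]; group
    simp [hA, mul_assoc, this]
  have Bt : B t = t * y := by simp [hB, mul_assoc, hy]
  have Bx : B x = x * w := by simp [hB, mul_assoc, hw]
  have By : B y = y := by simp [hB, mul_assoc, hyb.eq]
  have Bw : B w = w := by simp [hB, mul_assoc, hwb.eq]
  have hxq : x ^ q = 1 := by
    have := MulAut.pow_apply_of_mul A At Ax q
    rwa [Aq, MulAut.one_apply, eq_comm, mul_eq_left] at this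
  have hyq : y ^ q = 1 := by
    have := MulAut.pow_apply_of_mul B Bt By q
    rwa [Bq, MulAut.one_apply, eq_comm, mul_eq_left] at this
  have hwq : w ^ q = 1 := by
    have := MulAut.pow_apply_of_mul B Bx Bw q
    rwa [Bq, MulAut.one_apply, eq_comm, mul_eq_left] at this
  have Ati : A t⁻¹ = t⁻¹ * x⁻¹ := by rw [map_inv, At, ← hxt.eq, mul_inv_rev]
  have Axi : A x⁻¹ = x⁻¹ := by rw [map_inv, Ax]
  have htxi : Commute t⁻¹ x⁻¹ := hxt.symm.inv_left.inv_right
  have hpow (n : ℕ) : (A ^ n) b = b * t⁻¹ ^ n * x⁻¹ ^ n.choose 2 :=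
    MulAut.pow_apply_of_unipotent A Ab Ati Axi htxi n
  have htq : t⁻¹ ^ q * x⁻¹ ^ q.choose 2 = 1 := by
    have := hpow q
    rwa [Aq, MulAut.one_apply, eq_comm, mul_assoc, mul_eq_left] at this
  have Bti : B t⁻¹ = t⁻¹ * y⁻¹ := by rw [map_inv, Bt, ← hyt.eq, mul_inv_rev]
  have Bxi : B x⁻¹ = x⁻¹ * w⁻¹ := by rw [map_inv, Bx, ← hwx.eq, mul_inv_rev]
  -- Conjugating `htq` by `b` leaves only this new factor. It sharpens `w ^ q = 1` when `q` is a
  -- power of 2.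
  have hwq' : w ^ q.choose 2 = 1 := by
    have := congrArg B htq
    rw [map_mul, map_pow, map_pow, Bti, Bxi, hyt.symm.inv_left.inv_right.mul_pow,
      hwx.symm.inv_left.inv_right.mul_pow, inv_pow y, hyq, inv_one, mul_one, ← mul_assoc, htq,
      one_mul, map_one, inv_pow, inv_eq_one] at this
    exact this
  have htm : t⁻¹ ^ (m * m) = 1 := by
    have h : t⁻¹ ^ q = x ^ q.choose 2 := by
      rw [eq_inv_of_mul_eq_one_left htq, inv_pow, inv_inv]
    obtain ⟨c, hc⟩ := hj'
    rw [hj, pow_mul, h, ← pow_mul, mul_comm, hc, pow_mul, hxq, one_pow]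
  set C := m.choose 2 with hC
  obtain ⟨e, he⟩ : ∃ e, e = t⁻¹ ^ m * x⁻¹ ^ C := ⟨_, rfl⟩
  obtain ⟨f, hf⟩ : ∃ f, f = y⁻¹ ^ m * w⁻¹ ^ C := ⟨_, rfl⟩
  have hyxi : Commute y⁻¹ x⁻¹ := hxy.symm.inv_left.inv_right
  have hwyi : Commute y⁻¹ w⁻¹ := hwy.symm.inv_left.inv_right
  have Be : B e = e * f := by
    rw [he, hf, map_mul, map_pow, map_pow, Bti, Bxi, hyt.symm.inv_left.inv_right.mul_pow,
      hwx.symm.inv_left.inv_right.mul_pow, mul_assoc, ← mul_assoc (y⁻¹ ^ m),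
      (hyxi.pow_pow m C).eq]
    simp only [mul_assoc]
  have Bf : B f = f := by rw [hf]; simp only [map_mul, map_pow, map_inv, By, Bw]
  have hef : Commute e f := by
    rw [he, hf]
    have c1 : Commute t⁻¹ y⁻¹ := hyt.symm.inv_left.inv_right
    have c2 : Commute t⁻¹ w⁻¹ := hwt.symm.inv_left.inv_right
    have c3 : Commute x⁻¹ w⁻¹ := hwx.symm.inv_left.inv_right
    exact ((c1.pow_pow _ _).mul_right (c2.pow_pow _ _)).mul_left
      ((hyxi.symm.pow_pow _ _).mul_right (c3.pow_pow _ _))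
  have hbe : (b * e) ^ m = b ^ m * e ^ m * f ^ C :=
    mul_pow_of_conj (by rwa [← hB]) (by rwa [← hB]) hef m
  have one_of_dvd {g : G} {k l : ℕ} (hg : g ^ k = 1) (h : k ∣ l) : g⁻¹ ^ l = 1 := by
    rw [inv_pow, inv_eq_one, ← orderOf_dvd_iff_pow_eq_one]
    exact (orderOf_dvd_of_pow_eq_one hg).trans h
  have hem : e ^ m = 1 := by
    rw [he, (htxi.pow_pow _ _).mul_pow, ← pow_mul, ← pow_mul, htm, one_mul]
    exact one_of_dvd hxq (by rwa [mul_comm])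
  have hfm : f ^ C = 1 := by
    rw [hf, (hwyi.pow_pow _ _).mul_pow, ← pow_mul, ← pow_mul, one_of_dvd hyq hm, one_mul]
    refine one_of_dvd (k := q.gcd (q.choose 2)) ?_ hqm
    rw [← orderOf_dvd_iff_pow_eq_one]
    exact Nat.dvd_gcd (orderOf_dvd_of_pow_eq_one hwq) (orderOf_dvd_of_pow_eq_one hwq')
  have key : (A ^ m) (b ^ m) = b ^ m := by
    rw [map_pow, hpow, mul_assoc, ← hC, ← he, hbe, hem, hfm, mul_one, mul_one]
  rw [hA, ← map_pow, MulAut.conj_apply, inv_pow, inv_inv] at key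
  rw [Commute, SemiconjBy]
  conv_lhs => rw [← key]
  group

end Powers

/-! ### Subnormality by induction on the exponent -/

section Subnormal

variable {G : Type*} [Group G]

theorem engelComm_succ' (x y : G) (n : ℕ) :
    engelComm x y (n + 1) = engelComm (rcomm x y) y n := by
  induction n with
  | zero => rfl
  | succ n ih => rw [engelComm, ih, engelComm]

/-- If `X` is an abelian subgroup normalized by `a` on which `a` acts as an Engel element, then
`⟨c⟩` is subnormal in `⟨c, X⟩` for every power `c` of `a`. -/
theorem isSubnormal_zpowers_of_sup {a : G} {r n : ℕ} {X : Subgroup G}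
    (hX : ∀ z ∈ X, ∀ z' ∈ X, z * z' = z' * z) (haX : ∀ z ∈ X, a⁻¹ * z * a ∈ X)
    (hE : ∀ z ∈ X, engelComm z a n = 1)
    (hs : (Subgroup.zpowers (a ^ r) ⊔ X).IsSubnormal) :
    (Subgroup.zpowers (a ^ r)).IsSubnormal := by
  induction n generalizing X with
  | zero =>
    have : X = ⊥ := (Subgroup.eq_bot_iff_forall X).2 hE
    rwa [this, sup_bot_eq] at hs
  | succ n ih =>
    have hr (z : G) : rcomm z a = z⁻¹ * (a⁻¹ * z * a) := by simp [rcomm, mul_assoc]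
    have hmul {z z' : G} (hz : z ∈ X) (hz' : z' ∈ X) :
        rcomm (z * z') a = rcomm z a * rcomm z' a := by
      rw [hr, hr, hr]
      calc (z * z')⁻¹ * (a⁻¹ * (z * z') * a) = z'⁻¹ * (z⁻¹ * (a⁻¹ * z * a)) * (a⁻¹ * z' * a) := by
            group
        _ = _ := by
          rw [hX _ (X.inv_mem hz') _ (X.mul_mem (X.inv_mem hz) (haX z hz))]; group
    -- `Y = [X, a]` is the image of the endomorphism `z ↦ [z, a]` of the abelian group `X`. Passing
    -- to it lowers the Engel length by one, and `X` normalizes `⟨a ^ r⟩Y` because `[X, a ^ r] ≤ Y`.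
    let Y : Subgroup G :=
      { carrier := {u | ∃ z ∈ X, rcomm z a = u}
        one_mem' := ⟨1, X.one_mem, by simp [rcomm]⟩
        mul_mem' := by
          rintro _ _ ⟨z, hz, rfl⟩ ⟨z', hz', rfl⟩
          exact ⟨z * z', X.mul_mem hz hz', hmul hz hz'⟩
        inv_mem' := by
          rintro _ ⟨z, hz, rfl⟩
          refine ⟨z⁻¹, X.inv_mem hz, eq_inv_of_mul_eq_one_left ?_⟩
          rw [← hmul (X.inv_mem hz) hz]; simp [rcomm] }
    have hYX : Y ≤ X := by
      rintro _ ⟨z, hz, rfl⟩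
      rw [hr]
      exact X.mul_mem (X.inv_mem hz) (haX z hz)
    refine ih (X := Y) (fun z hz z' hz' => hX z (hYX hz) z' (hYX hz')) ?_ ?_ ?_
    · rintro _ ⟨z, hz, rfl⟩
      exact ⟨a⁻¹ * z * a, haX z hz, by simp [rcomm, mul_assoc]⟩
    · rintro _ ⟨z, hz, rfl⟩
      rw [← engelComm_succ']
      exact hE z hz
    · have hpow (k : ℕ) {z : G} (hz : z ∈ X) :
          (a ^ k)⁻¹ * z * a ^ k ∈ X ∧ z⁻¹ * ((a ^ k)⁻¹ * z * a ^ k) ∈ Y := by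
        induction k with
        | zero => simpa using hz
        | succ k ihk =>
          have h : (a ^ (k + 1))⁻¹ * z * a ^ (k + 1) = a⁻¹ * ((a ^ k)⁻¹ * z * a ^ k) * a := by
            rw [pow_succ]; group
          rw [h]
          refine ⟨haX _ ihk.1, ?_⟩
          have h2 : rcomm ((a ^ k)⁻¹ * z * a ^ k) a ∈ Y := ⟨_, ihk.1, rfl⟩
          have := Y.mul_mem ihk.2 h2
          rw [hr] at this
          convert this using 1
          group
      have hconj {z : G} (hz : z ∈ X) : ∀ h ∈ Subgroup.zpowers (a ^ r) ⊔ Y,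
          z * h * z⁻¹ ∈ Subgroup.zpowers (a ^ r) ⊔ Y := by
        suffices Subgroup.zpowers (a ^ r) ⊔ Y ≤
            (Subgroup.zpowers (a ^ r) ⊔ Y).comap (MulAut.conj z).toMonoidHom from
          fun h hh => this hh
        refine sup_le (Subgroup.zpowers_le.2 ?_) fun u hu => ?_
        · rw [Subgroup.mem_comap]
          have h1 : z * a ^ r * z⁻¹ = a ^ r * (z⁻¹⁻¹ * ((a ^ r)⁻¹ * z⁻¹ * a ^ r))⁻¹ := by
            group
          rw [MulEquiv.toMonoidHom_eq_coe, MonoidHom.coe_coe, MulAut.conj_apply, h1]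
          exact Subgroup.mul_mem _ (Subgroup.mem_sup_left (Subgroup.mem_zpowers _))
            (Subgroup.mem_sup_right (Y.inv_mem (hpow r (X.inv_mem hz)).2))
        · have h1 : z * u * z⁻¹ = u := by rw [hX z hz u (hYX hu)]; group
          rw [Subgroup.mem_comap]
          simpa [h1] using Subgroup.mem_sup_right hu
      refine .step _ _ (sup_le_sup_left hYX _) hs
        (Subgroup.normal_subgroupOf_of_le_normalizer (sup_le (le_sup_left.trans
          Subgroup.le_normalizer) fun z hz => Subgroup.mem_normalizer_iff.2 fun h =>
            ⟨hconj hz h, fun hh => ?_⟩))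
      have := hconj (X.inv_mem hz) _ hh
      convert this using 1
      group

/-- The normal closure centralizes `c`, so `c` lies in its centralizer; that is a normal subgroup,
hence contains the whole closure. -/
theorem normalClosure_singleton_commute {c : G} (hc : ∀ b, IsConj c b → Commute c b) :
    ∀ z ∈ Subgroup.normalClosure {c}, ∀ z' ∈ Subgroup.normalClosure {c}, z * z' = z' * z := by
  have h : Subgroup.normalClosure {c} ≤
      Subgroup.centralizer (Subgroup.normalClosure {c} : Set G) := by
    have h1 : c ∈ Subgroup.centralizer (Subgroup.normalClosure {c} : Set G) := by
      have : Subgroup.normalClosure {c} ≤ Subgroup.centralizer {c} := by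
        rw [Subgroup.normalClosure, Subgroup.closure_le]
        intro b hb
        simp only [Group.conjugatesOfSet, Set.mem_singleton_iff, Set.iUnion_iUnion_eq_left] at hb
        exact Subgroup.mem_centralizer_singleton_iff.2 (hc b hb).symm.eq
      rw [Subgroup.mem_centralizer_iff]
      intro z hz
      exact Subgroup.mem_centralizer_singleton_iff.1 (this hz)
    exact Subgroup.normalClosure_le_normal (by simpa using h1)
  intro z hz z' hz'
  exact (Subgroup.mem_centralizer_iff.1 (h hz) z' hz').symm

theorem isSubnormal_zpowers_pow {p s : ℕ}
    (hnum : ∀ n, s < n → ∃ j, p ^ (n - 1) * p ^ (n - 1) = p ^ n * j ∧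
      p ^ n ∣ j * (p ^ n).choose 2 ∧ p ^ n ∣ p ^ (n - 1) * (p ^ (n - 1)).choose 2 ∧
      (p ^ n).gcd ((p ^ n).choose 2) ∣ (p ^ (n - 1)).choose 2 * (p ^ (n - 1)).choose 2)
    {a : G} (ha : a ∈ leftEngel G 4) (ha' : a⁻¹ ∈ leftEngel G 4) {n : ℕ} (hn : a ^ p ^ n = 1) :
    (Subgroup.zpowers (a ^ p ^ s)).IsSubnormal := by
  induction n generalizing G with
  | zero =>
    have : a = 1 := by simpa using hn
    simp [this]
  | succ n ih =>
    rcases le_or_gt (n + 1) s with h | h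
    · have : a ^ p ^ s = 1 := by
        obtain ⟨k, hk⟩ := pow_dvd_pow p h
        rw [hk, pow_mul, hn, one_pow]
      simp [this]
    obtain ⟨j, h1, h2, h3, h4⟩ := hnum (n + 1) h
    rw [Nat.add_sub_cancel] at h1 h3 h4
    set N := Subgroup.normalClosure {a ^ p ^ n} with hN
    have hcomm := normalClosure_singleton_commute (c := a ^ p ^ n) fun b hb => by
      obtain ⟨g, rfl⟩ := isConj_iff.1 hb
      rw [← conj_pow]
      exact commute_pow_of_leftEngel ha ha' (isConj_iff.2 ⟨g, rfl⟩) hn h1 h2 h3 h4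
    have hsurj := QuotientGroup.mk'_surjective N
    have hq := ih (G := G ⧸ N) (a := QuotientGroup.mk' N a) (map_mem_leftEngel hsurj ha)
      (by rw [← map_inv]; exact map_mem_leftEngel hsurj ha')
      (by
        rw [← map_pow, QuotientGroup.mk'_apply, QuotientGroup.eq_one_iff]
        exact Subgroup.subset_normalClosure rfl)
    have hsub := hq.comap (QuotientGroup.mk' N)
    rw [← map_pow, ← MonoidHom.map_zpowers, Subgroup.comap_map_eq, QuotientGroup.ker_mk'] at hsub
    refine isSubnormal_zpowers_of_sup (X := N) (n := 4) hcomm (fun z hz => ?_)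
      (fun z _ => ha z) hsub
    simpa using (Subgroup.normalClosure_normal (s := {a ^ p ^ n})).conj_mem z hz a⁻¹

end Subnormal

/-! ### Divisibility for prime powers, and the conclusion -/

theorem odd_prime_pow_arith {p : ℕ} (hp : Odd p) (n : ℕ) (hn : 1 < n) :
    ∃ j, p ^ (n - 1) * p ^ (n - 1) = p ^ n * j ∧
      p ^ n ∣ j * (p ^ n).choose 2 ∧ p ^ n ∣ p ^ (n - 1) * (p ^ (n - 1)).choose 2 ∧
      (p ^ n).gcd ((p ^ n).choose 2) ∣ (p ^ (n - 1)).choose 2 * (p ^ (n - 1)).choose 2 := by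
  have hdvd {q : ℕ} (hq : Odd q) : q ∣ q.choose 2 := by
    obtain ⟨k, rfl⟩ := hq
    refine ⟨k, ?_⟩
    rw [Nat.choose_two_right, Nat.add_sub_cancel, mul_left_comm, Nat.mul_div_cancel_left _ two_pos]
  obtain ⟨k, rfl⟩ := Nat.exists_eq_add_of_le' hn
  have hm := hdvd (hp.pow (n := k + 2 - 1))
  have h0 : p ^ (k + 2 - 1) * p ^ (k + 2 - 1) = p ^ (k + 2) * p ^ k := by
    rw [← pow_add, ← pow_add]; congr 1; omega
  exact ⟨p ^ k, h0, (hdvd hp.pow).mul_left _,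
    (Dvd.intro _ h0.symm).trans (Nat.mul_dvd_mul_left _ hm),
    (Nat.gcd_dvd_left _ _).trans ((Dvd.intro _ h0.symm).trans (Nat.mul_dvd_mul hm hm))⟩

/-- The gcd is `2 ^ (n - 1)`, while the 2-part of the right side is `2 ^ (2 * (n - 2))`, so `n = 3`
just works; divisibility by `2 ^ n` itself would fail there. At `n = 2` the conditions fail, whence
`a ^ 4`. -/
theorem two_pow_arith (n : ℕ) (hn : 2 < n) :
    ∃ j, 2 ^ (n - 1) * 2 ^ (n - 1) = 2 ^ n * j ∧
      2 ^ n ∣ j * (2 ^ n).choose 2 ∧ 2 ^ n ∣ 2 ^ (n - 1) * (2 ^ (n - 1)).choose 2 ∧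
      (2 ^ n).gcd ((2 ^ n).choose 2) ∣ (2 ^ (n - 1)).choose 2 * (2 ^ (n - 1)).choose 2 := by
  have hc (k : ℕ) : (2 ^ (k + 1)).choose 2 = 2 ^ k * (2 ^ (k + 1) - 1) := by
    rw [Nat.choose_two_right, pow_succ', mul_assoc, Nat.mul_div_cancel_left _ two_pos]
  obtain ⟨k, rfl⟩ := Nat.exists_eq_add_of_le' hn
  have e : k + 2 + 1 - 1 = k + 1 + 1 := rfl
  rw [e, hc, hc]
  refine ⟨2 ^ (k + 1), by ring, ⟨2 ^ k * (2 ^ (k + 2 + 1) - 1), by ring⟩,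
    ⟨2 ^ k * (2 ^ (k + 1 + 1) - 1), by ring⟩, ?_⟩
  have hodd : Nat.Coprime 2 (2 ^ (k + 2 + 1) - 1) := Nat.coprime_two_left.2 <|
    Nat.Even.sub_odd Nat.one_le_two_pow (even_two.pow_of_ne_zero (by simp)) odd_one
  rw [pow_succ 2 (k + 2), Nat.gcd_mul_left, ← pow_succ 2 (k + 2), hodd.gcd_eq_one, mul_one]
  exact ⟨2 ^ k * ((2 ^ (k + 1 + 1) - 1) * (2 ^ (k + 1 + 1) - 1)), by ring⟩

theorem theorem1p6 {G : Type*} [Group G] (p : ℕ) (hp : p.Prime) (a : G)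
    (hpa : ∃ k : ℕ, orderOf a = p ^ k)
    (ha : a ∈ leftEngel G 4) (ha' : a⁻¹ ∈ leftEngel G 4) :
    (p = 2 → a ^ 4 ∈ baerRadical G) ∧ (Odd p → a ^ p ∈ baerRadical G) := by
  obtain ⟨k, hk⟩ := hpa
  have hn : a ^ p ^ k = 1 := by rw [← hk, pow_orderOf_eq_one]
  have mem {c : G} (hc : (Subgroup.zpowers c).IsSubnormal) : c ∈ baerRadical G :=
    le_sSup (s := {H : Subgroup G | IsCyclic H ∧ H.IsSubnormal}) ⟨inferInstance, hc⟩
      (Subgroup.mem_zpowers c)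
  refine ⟨?_, fun hodd => ?_⟩
  · rintro rfl
    exact mem (isSubnormal_zpowers_pow (s := 2) two_pow_arith ha ha' hn)
  · have := isSubnormal_zpowers_pow (s := 1) (odd_prime_pow_arith hodd) ha ha' hn
    rw [pow_one] at this
    exact mem this
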